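/- Let $n\ge 1$, let $B^n(0,r)\subset\mathbb{C}^n$ be the open Euclidean ball of radius $r$ centred at $0$, and let $B^n=B^n(0,1)$. For a bounded domain (a bounded, non-empty, connected open set) $D\subset\mathbb{C}^n$ and $p\in D$, define the squeezing function of $D$ by $$s_D(p)=\sup_f\ \sup\{r : B^n(0,r)\subset f(D)\},$$ where $f$ runs over all holomorphic embeddings $f:D\to B^n$ (biholomorphic maps of $D$ onto an open subset of $B^n$) with $f(p)=0$. The domain $D$ is called holomorphic homogeneous regular if there is a constant $c>0$ such that $s_D(p)\ge c$ for all $p\in D$. Then every holomorphic homogeneous regular domain $D\subset\mathbb{C}^n$ is pseudoconvex, that is, there is a continuous plurisubharmonic function $u:D\to\mathbb{R}$ such that $\{z\in D : u(z)\le t\}$ is compact for every $t\in\mathbb{R}$. -/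

import Mathlib

namespace SCV

/-- Holomorphic embeddings of `D` into the open unit ball `B^n` (source and target have the same
dimension `n`): holomorphic maps of `D` into `B^n` that are immersions and homeomorphisms of `D`
onto an open image. -/
structure IsHolomorphicEmbeddingInBall {n : ℕ} (D : Set (EuclideanSpace ℂ (Fin n)))
    (f : EuclideanSpace ℂ (Fin n) → EuclideanSpace ℂ (Fin n)) : Prop where
  mapsTo : Set.MapsTo f D (Metric.ball 0 1)
  holomorphic : DifferentiableOn ℂ f D
  immersion : ∀ z ∈ D, Function.Injective (fderiv ℂ f z)
  isOpenEmbedding : Topology.IsOpenEmbedding (D.domRestrict f)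

/-- The number `s_D(p, f) = sup {r | B^n(0, r) ⊆ f(D)}`. For `n ≥ 1` and an embedding `f` of `D`
into `B^n`, the set contains `0` and is bounded above by `1`. -/
noncomputable def squeezingNumberOf {n : ℕ} (D : Set (EuclideanSpace ℂ (Fin n)))
    (f : EuclideanSpace ℂ (Fin n) → EuclideanSpace ℂ (Fin n)) : ℝ :=
  sSup {r : ℝ | Metric.ball 0 r ⊆ f '' D}

/-- The squeezing function `s_D(p)`: the supremum of `s_D(p, f)` over all holomorphic embeddings
`f : D → B^n` with `f p = 0`. -/
noncomputable def squeezingFunction {n : ℕ} (D : Set (EuclideanSpace ℂ (Fin n)))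
    (p : EuclideanSpace ℂ (Fin n)) : ℝ :=
  sSup {s : ℝ | ∃ f : EuclideanSpace ℂ (Fin n) → EuclideanSpace ℂ (Fin n),
    IsHolomorphicEmbeddingInBall D f ∧ f p = 0 ∧ s = squeezingNumberOf D f}

/-- Bounded domains (non-empty connected open sets) in `ℂ^n`. -/
structure IsBoundedDomain {n : ℕ} (D : Set (EuclideanSpace ℂ (Fin n))) : Prop where
  isOpen : IsOpen D
  isConnected : IsConnected D
  isBounded : Bornology.IsBounded D

/-- Holomorphic homogeneous regular domains: bounded domains whose squeezing function admits a
positive lower bound. -/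
structure IsHolomorphicHomogeneousRegular {n : ℕ} (D : Set (EuclideanSpace ℂ (Fin n))) :
    Prop where
  isBoundedDomain : IsBoundedDomain D
  exists_lower_bound : ∃ c : ℝ, 0 < c ∧ ∀ p ∈ D, c ≤ squeezingFunction D p

/-- Continuous real-valued plurisubharmonic functions on `D`: the sub-mean value inequality holds
on every closed affine complex disc contained in `D`. -/
structure IsContinuousPlurisubharmonicOn {n : ℕ} (u : EuclideanSpace ℂ (Fin n) → ℝ)
    (D : Set (EuclideanSpace ℂ (Fin n))) : Prop where
  continuousOn : ContinuousOn u D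
  le_circleAverage : ∀ z v : EuclideanSpace ℂ (Fin n),
    (∀ ζ : ℂ, ‖ζ‖ ≤ 1 → z + ζ • v ∈ D) →
      u z ≤ Real.circleAverage (fun ζ : ℂ => u (z + ζ • v)) 0 1

/-- Pseudoconvex open sets: those that carry a continuous plurisubharmonic exhaustion function. -/
def IsPseudoconvex {n : ℕ} (D : Set (EuclideanSpace ℂ (Fin n))) : Prop :=
  IsOpen D ∧ ∃ u : EuclideanSpace ℂ (Fin n) → ℝ, IsContinuousPlurisubharmonicOn u D ∧
    ∀ c : ℝ, IsCompact {z | z ∈ D ∧ u z ≤ c}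

end SCV

/-! Let `δ` be the distance to the complement of `D`, and let `f` embed `D` with `f z = 0` and image
containing the ball of radius `c`. Put `τ = c / (1 + c)` and suppose `δ z < τ / 2 * r`. Then some `w
= z + (τ / 2) • v` with `‖v‖ < r` lies outside `D`.

If all Taylor coefficients of `f` at `z` in direction `v` had norm at most 1, the Taylor series
would map the disc of radius `τ` into the ball of radius `c`. Composing with the inverse of `f`
would recover the line through `z` and force `w` into `D` (`add_smul_mem`). So some coefficient
exceeds 1 at `z`, while Cauchy's estimate bounds it by 1 wherever `δ ≥ r`. A norming functional
turns it into a scalar function separating `z` from `{δ ≥ r}` (`exists_separating_of_squeezing`).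

Moduli of high powers of such functions, added up over compact shells approaching the boundary, give
the exhaustion (`isPseudoconvex_of_separating`). -/

namespace SCV

open Metric Set Filter Topology

/-! ### Directional derivatives of functions holomorphic along lines -/

section LineHolomorphic

variable {E F G : Type*} [NormedAddCommGroup E] [NormedSpace ℂ E]
  [NormedAddCommGroup F] [NormedSpace ℂ F] [NormedAddCommGroup G] [NormedSpace ℂ G]

/-- Continuous maps on `D` that are holomorphic along every complex line. -/
structure IsLineHolomorphicOn (f : E → F) (D : Set E) : Prop where
  continuousOn : ContinuousOn f D
  differentiableOn_line : ∀ z v : E,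
    DifferentiableOn ℂ (fun ζ : ℂ => f (z + ζ • v)) {ζ : ℂ | z + ζ • v ∈ D}

theorem isOpen_setOf_add_smul_mem {D : Set E} (hD : IsOpen D) (z v : E) :
    IsOpen {ζ : ℂ | z + ζ • v ∈ D} :=
  hD.preimage (by fun_prop : Continuous fun ζ : ℂ => z + ζ • v)

theorem isLineHolomorphicOn_of_differentiableOn {f : E → F} {D : Set E}
    (hf : DifferentiableOn ℂ f D) : IsLineHolomorphicOn f D where
  continuousOn := hf.continuousOn
  differentiableOn_line z v :=
    hf.comp (by fun_prop : Differentiable ℂ fun ζ : ℂ => z + ζ • v).differentiableOn fun _ hζ => hζ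

theorem IsLineHolomorphicOn.clm_comp {f : E → F} {D : Set E} (hf : IsLineHolomorphicOn f D)
    (ℓ : F →L[ℂ] G) : IsLineHolomorphicOn (fun z => ℓ (f z)) D where
  continuousOn := ℓ.continuous.comp_continuousOn hf.continuousOn
  differentiableOn_line z v := ℓ.differentiable.comp_differentiableOn (hf.differentiableOn_line z v)

theorem IsLineHolomorphicOn.pow {f : E → ℂ} {D : Set E} (hf : IsLineHolomorphicOn f D) (m : ℕ) :
    IsLineHolomorphicOn (fun z => f z ^ m) D where
  continuousOn := hf.continuousOn.pow m
  differentiableOn_line z v := (hf.differentiableOn_line z v).fun_pow m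

/-- Difference quotients in a fixed direction converge locally uniformly. -/
theorem IsLineHolomorphicOn.exists_ball_tendstoUniformlyOn [CompleteSpace F] {f : E → F} {D : Set E}
    (hf : IsLineHolomorphicOn f D) (hD : IsOpen D) (v : E) {y₀ : E} (hy₀ : y₀ ∈ D) :
    ∃ ε > 0, ball y₀ ε ⊆ D ∧ (∀ᶠ t : ℂ in 𝓝[≠] 0, ∀ y ∈ ball y₀ ε, y + t • v ∈ D) ∧
      TendstoUniformlyOn (fun (t : ℂ) y => t⁻¹ • (f (y + t • v) - f y))
        (fun y => lineDeriv ℂ f y v) (𝓝[≠] 0) (ball y₀ ε) := by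
  obtain ⟨ε₁, hε₁, h₁⟩ : ∃ ε > 0, ball y₀ ε ⊆ D ∩ {y | dist (f y) (f y₀) < 1 / 2} := by
    refine Metric.mem_nhds_iff.1 (inter_mem (hD.mem_nhds hy₀) ?_)
    exact (hf.continuousOn.continuousAt (hD.mem_nhds hy₀)).eventually
      (Metric.ball_mem_nhds _ (by norm_num))
  have hv : 0 < ‖v‖ + 1 := by positivity
  set R := ε₁ / 2 / (‖v‖ + 1) with hR
  have hRpos : 0 < R := by positivity
  have hmem : ∀ y ∈ ball y₀ (ε₁ / 2), ∀ t : ℂ, ‖t‖ < R → y + t • v ∈ ball y₀ ε₁ := by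
    intro y hy t ht
    rw [mem_ball_iff_norm] at hy ⊢
    have h2 : ‖t • v‖ ≤ ε₁ / 2 := by
      rw [norm_smul]
      calc ‖t‖ * ‖v‖ ≤ R * (‖v‖ + 1) := by gcongr; linarith
        _ = ε₁ / 2 := by rw [hR]; field_simp
    calc ‖y + t • v - y₀‖ = ‖(y - y₀) + t • v‖ := by congr 1; abel
      _ ≤ ‖y - y₀‖ + ‖t • v‖ := norm_add_le _ _
      _ < ε₁ := by linarith
  have hball : ∀ᶠ t : ℂ in 𝓝[≠] 0, ‖t‖ < R :=
    nhdsWithin_le_nhds <| by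
      filter_upwards [ball_mem_nhds (0 : ℂ) hRpos] with t ht
      simpa using ht
  refine ⟨ε₁ / 2, by positivity, fun y hy => (h₁ (ball_subset_ball (by linarith) hy)).1,
    hball.mono fun t ht y hy => (h₁ (hmem y hy t ht)).1, ?_⟩
  -- Schwarz's lemma, used twice: it bounds the slope of `f` along the line by `1 / R`, then gives
  -- the slope a Lipschitz estimate at 0. The constants do not depend on `y`.
  have key : ∀ y ∈ ball y₀ (ε₁ / 2), ∀ t : ℂ, t ≠ 0 → ‖t‖ < R →
      dist (lineDeriv ℂ f y v) (t⁻¹ • (f (y + t • v) - f y)) ≤ (2 / R) / R * ‖t‖ := by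
    intro y hy t ht0 ht
    set g : ℂ → F := fun ζ => f (y + ζ • v) with hg
    have hgd : DifferentiableOn ℂ g (ball 0 R) := (hf.differentiableOn_line y v).mono fun ζ hζ =>
      (h₁ (hmem y hy ζ (by simpa using hζ))).1
    have hgm : MapsTo g (ball 0 R) (closedBall (g 0) 1) := by
      intro ζ hζ
      have a := (h₁ (hmem y hy ζ (by simpa using hζ))).2
      have b := (h₁ (hmem y hy 0 (by simpa using hRpos))).2
      simp only [mem_ofPred_eq] at a b
      have := dist_triangle_right (g ζ) (g 0) (f y₀)
      simp only [mem_closedBall, hg] at this ⊢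
      linarith
    have hb : ∀ ζ ∈ ball (0 : ℂ) R, ‖dslope g 0 ζ‖ ≤ 1 / R := fun ζ hζ =>
      Complex.norm_dslope_le_div_of_mapsTo_ball hgd hgm hζ
    have hd : DifferentiableOn ℂ (dslope g 0) (ball 0 R) :=
      (Complex.differentiableOn_dslope (ball_mem_nhds _ hRpos)).2 hgd
    have hm : MapsTo (dslope g 0) (ball 0 R) (closedBall (dslope g 0 0) (2 / R)) := by
      intro ζ hζ
      rw [mem_closedBall, dist_eq_norm]
      calc _ ≤ ‖dslope g 0 ζ‖ + ‖dslope g 0 0‖ := norm_sub_le _ _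
        _ ≤ 1 / R + 1 / R := add_le_add (hb _ hζ) (hb _ (mem_ball_self hRpos))
        _ = 2 / R := by ring
    have := Complex.dist_le_div_mul_dist_of_mapsTo_ball hd hm (z := t) (by simpa using ht)
    rw [dslope_same, dslope_of_ne _ ht0, slope_def_module] at this
    rw [dist_comm]
    simpa [hg, lineDeriv] using this
  rw [Metric.tendstoUniformlyOn_iff]
  intro η hη
  have hsmall : ∀ᶠ t : ℂ in 𝓝[≠] 0, (2 / R) / R * ‖t‖ < η := by
    refine nhdsWithin_le_nhds ?_
    have : Tendsto (fun t : ℂ => (2 / R) / R * ‖t‖) (𝓝 0) (𝓝 ((2 / R) / R * ‖(0 : ℂ)‖)) :=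
      (by fun_prop : Continuous fun t : ℂ => (2 / R) / R * ‖t‖).tendsto 0
    exact this.eventually_lt_const (by simpa using hη)
  filter_upwards [hball, hsmall, self_mem_nhdsWithin] with t h1 h2 h3 y hy
  exact (key y hy t h3 h1).trans_lt h2

/-- Continuity and holomorphy along lines pass to the locally uniform limit of difference quotients
(Weierstrass). Hence the class is stable under repeated differentiation. -/
theorem IsLineHolomorphicOn.lineDeriv [CompleteSpace F] {f : E → F} {D : Set E}
    (hf : IsLineHolomorphicOn f D) (hD : IsOpen D) (v : E) :
    IsLineHolomorphicOn (fun y => lineDeriv ℂ f y v) D where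
  continuousOn := by
    intro y₀ hy₀
    obtain ⟨ε, hε, hsub, hmem, hlim⟩ := hf.exists_ball_tendstoUniformlyOn hD v hy₀
    refine ((hlim.continuousOn (Eventually.frequently ?_)).continuousAt
      (ball_mem_nhds _ hε)).continuousWithinAt
    filter_upwards [hmem] with t ht
    refine ((hf.continuousOn.comp (by fun_prop) ht).sub (hf.continuousOn.mono hsub)).const_smul _
  differentiableOn_line z w := by
    intro ζ₀ hζ₀
    obtain ⟨ε, hε, hsub, hmem, hlim⟩ := hf.exists_ball_tendstoUniformlyOn hD v hζ₀
    have hU : IsOpen {ζ : ℂ | z + ζ • w ∈ ball (z + ζ₀ • w) ε} :=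
      isOpen_setOf_add_smul_mem isOpen_ball z w
    have hlim' := (hlim.comp fun ζ : ℂ => z + ζ • w).tendstoLocallyUniformlyOn
    refine ((hlim'.differentiableOn ?_ hU).differentiableAt
      (hU.mem_nhds (mem_ball_self hε))).differentiableWithinAt
    filter_upwards [hmem] with t ht
    refine DifferentiableOn.const_smul (DifferentiableOn.sub ?_ ?_) _
    · refine ((hf.differentiableOn_line (z + t • v) w).mono fun ζ hζ => ?_).congr fun ζ _ => ?_
      · have := ht _ hζ
        simpa only [mem_ofPred_eq, add_right_comm] using this
      · simp only [add_right_comm]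
    · exact (hf.differentiableOn_line z w).mono fun ζ hζ => hsub hζ

/-- The `k`-th derivative of `f` in the direction `v`. -/
noncomputable def iteratedLineDeriv (k : ℕ) (f : E → F) (v y : E) : F :=
  iteratedDeriv k (fun ζ : ℂ => f (y + ζ • v)) 0

theorem iteratedDeriv_line (k : ℕ) (f : E → F) (v y : E) (ζ : ℂ) :
    iteratedDeriv k (fun ζ : ℂ => f (y + ζ • v)) ζ = iteratedLineDeriv k f v (y + ζ • v) := by
  have := congrFun (iteratedDeriv_comp_const_add k (fun ζ : ℂ => f (y + ζ • v)) ζ) 0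
  rw [add_zero] at this
  rw [← this, iteratedLineDeriv]
  simp only [add_smul, add_assoc]

theorem iteratedLineDeriv_succ (k : ℕ) (f : E → F) (v y : E) :
    iteratedLineDeriv (k + 1) f v y = _root_.lineDeriv ℂ (iteratedLineDeriv k f v) y v := by
  rw [iteratedLineDeriv, iteratedDeriv_succ, _root_.lineDeriv]
  congr 1
  exact funext (iteratedDeriv_line k f v y)

theorem IsLineHolomorphicOn.iteratedLineDeriv [CompleteSpace F] {f : E → F} {D : Set E}
    (hf : IsLineHolomorphicOn f D) (hD : IsOpen D) (v : E) (k : ℕ) :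
    IsLineHolomorphicOn (iteratedLineDeriv k f v) D := by
  induction k with
  | zero =>
    have : SCV.iteratedLineDeriv 0 f v = f := by ext y; simp [SCV.iteratedLineDeriv]
    rwa [this]
  | succ k ih =>
    have : SCV.iteratedLineDeriv (k + 1) f v =
        fun y => _root_.lineDeriv ℂ (SCV.iteratedLineDeriv k f v) y v :=
      funext (iteratedLineDeriv_succ k f v)
    rw [this]
    exact ih.lineDeriv hD v

theorem IsLineHolomorphicOn.diffContOnCl_line {f : E → F} {D : Set E}
    (hf : IsLineHolomorphicOn f D) {z v : E} (h : ∀ ζ : ℂ, ‖ζ‖ ≤ 1 → z + ζ • v ∈ D) :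
    DiffContOnCl ℂ (fun ζ : ℂ => f (z + ζ • v)) (ball 0 1) := by
  refine DifferentiableOn.diffContOnCl ((hf.differentiableOn_line z v).mono fun ζ hζ => h ζ ?_)
  simpa using closure_ball_subset_closedBall hζ

theorem IsLineHolomorphicOn.norm_iteratedLineDeriv_le [CompleteSpace F] {f : E → F} {D : Set E}
    (hf : IsLineHolomorphicOn f D) {M : ℝ} (hM : ∀ z ∈ D, ‖f z‖ ≤ M) {z v : E}
    (h : ∀ ζ : ℂ, ‖ζ‖ ≤ 1 → z + ζ • v ∈ D) (k : ℕ) :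
    ‖SCV.iteratedLineDeriv k f v z‖ ≤ k.factorial * M := by
  have := Complex.norm_iteratedDeriv_le_of_forall_mem_sphere_norm_le k one_pos
    (hf.diffContOnCl_line h) (C := M) fun ζ hζ => hM _ (h ζ (by simpa using hζ.le))
  simpa [SCV.iteratedLineDeriv] using this

theorem IsLineHolomorphicOn.norm_le_circleAverage [CompleteSpace F] {f : E → F} {D : Set E}
    (hf : IsLineHolomorphicOn f D) {z v : E} (h : ∀ ζ : ℂ, ‖ζ‖ ≤ 1 → z + ζ • v ∈ D) :
    ‖f z‖ ≤ Real.circleAverage (fun ζ : ℂ => ‖f (z + ζ • v)‖) 0 1 := by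
  have hd := hf.diffContOnCl_line h
  have h1 : Real.circleAverage (fun ζ : ℂ => f (z + ζ • v)) 0 1 = f z := by
    have := DiffContOnCl.circleAverage (R := 1) (by simpa using hd)
    simpa using this
  rw [← h1, Real.circleAverage_def, Real.circleAverage_def, norm_smul, smul_eq_mul,
    Real.norm_of_nonneg (by positivity)]
  gcongr
  exact intervalIntegral.norm_integral_le_integral_norm (by positivity)

end LineHolomorphic

/-! ### Embeddings into the ball and separation -/

/-- The injective derivative is invertible because dimensions agree, and openness of `f` makes the
inverse continuous; together these make the inverse differentiable. -/
theorem IsHolomorphicEmbeddingInBall.exists_inverse {n : ℕ} {D U : Set (EuclideanSpace ℂ (Fin n))}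
    {f : EuclideanSpace ℂ (Fin n) → EuclideanSpace ℂ (Fin n)} (hD : IsOpen D)
    (hf : IsHolomorphicEmbeddingInBall D f) (hU : IsOpen U) (hUf : U ⊆ f '' D) :
    ∃ g : EuclideanSpace ℂ (Fin n) → EuclideanSpace ℂ (Fin n),
      DifferentiableOn ℂ g U ∧ MapsTo g U D ∧ ∀ z ∈ D, g (f z) = z := by
  have hinj : InjOn f D := by
    intro a ha b hb hab
    exact congrArg Subtype.val (hf.isOpenEmbedding.injective (a₁ := ⟨a, ha⟩) (a₂ := ⟨b, hb⟩) hab)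
  have hleft : ∀ z ∈ D, Function.invFunOn f D (f z) = z := fun z hz =>
    hinj.leftInvOn_invFunOn hz
  have hright : ∀ w ∈ f '' D, f (Function.invFunOn f D w) = w := fun w hw =>
    Function.invFunOn_eq hw
  have hmaps : ∀ w ∈ f '' D, Function.invFunOn f D w ∈ D := fun w hw =>
    Function.invFunOn_mem hw
  refine ⟨Function.invFunOn f D, ?_, fun w hw => hmaps w (hUf hw), hleft⟩
  intro w hw
  set p := Function.invFunOn f D w with hp
  have hpD : p ∈ D := hmaps w (hUf hw)
  have hfp : f p = w := hright w (hUf hw)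
  have hcont : ContinuousAt (Function.invFunOn f D) w := by
    intro V hV
    rw [← hp] at hV
    obtain ⟨V', hV'V, hV'o, hpV'⟩ := _root_.mem_nhds_iff.1 hV
    have ho := hf.isOpenEmbedding.isOpenMap _ (hV'o.preimage (continuous_subtype_val (p := (· ∈ D))))
    refine mem_map.2 <| mem_of_superset (ho.mem_nhds ⟨⟨p, hpD⟩, hpV', hfp⟩) ?_
    rintro _ ⟨x, hx, rfl⟩
    have : Function.invFunOn f D (D.domRestrict f x) = x := hleft x x.2
    rw [mem_preimage, this]
    exact hV'V hx
  have hd : DifferentiableAt ℂ f p := (hf.holomorphic p hpD).differentiableAt (hD.mem_nhds hpD)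
  let L := (LinearEquiv.ofInjectiveEndo (fderiv ℂ f p).toLinearMap
    (hf.immersion p hpD)).toContinuousLinearEquiv
  have hL : (L : _ →L[ℂ] _) = fderiv ℂ f p := by
    ext1 x; rfl
  have hg : HasFDerivAt (Function.invFunOn f D) (L.symm : _ →L[ℂ] _) w :=
    HasFDerivAt.of_local_left_inverse hcont (hL ▸ hd.hasFDerivAt)
      (mem_of_superset (hU.mem_nhds hw) fun y hy => hright y (hUf hy))
  exact hg.differentiableAt.differentiableWithinAt

/-- If all Taylor coefficients of `f` at `z` in direction `v` are bounded by one, where `f` embeds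
`D`, maps `z` to `0` and covers a ball of radius `c`, then `D` contains a disc of definite size in
the direction `v`. -/
theorem IsHolomorphicEmbeddingInBall.add_smul_mem {n : ℕ} {D : Set (EuclideanSpace ℂ (Fin n))}
    {f : EuclideanSpace ℂ (Fin n) → EuclideanSpace ℂ (Fin n)} (hD : IsOpen D)
    (hf : IsHolomorphicEmbeddingInBall D f) {c : ℝ} (hc : 0 < c) (hcf : ball 0 c ⊆ f '' D)
    {z : EuclideanSpace ℂ (Fin n)} (hz : z ∈ D) (hfz : f z = 0) {v : EuclideanSpace ℂ (Fin n)}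
    (hv : ∀ k : ℕ, ‖iteratedLineDeriv k f v z‖ ≤ k.factorial) {ζ : ℂ} (hζ : ‖ζ‖ < c / (1 + c)) :
    z + ζ • v ∈ D := by
  obtain ⟨g, hgd, hgm, hgl⟩ := hf.exists_inverse hD isOpen_ball hcf
  -- `τ` solves `τ / (1 - τ) = c`: the series has no constant term, so it is dominated by `‖ζ‖ / (1
  -- - ‖ζ‖)`.
  set τ := c / (1 + c) with hτ
  have hτ0 : 0 < τ := by positivity
  have hτ1 : τ < 1 := by rw [hτ, div_lt_one (by positivity)]; linarith
  set F : ℕ → ℂ → EuclideanSpace ℂ (Fin n) := fun k ζ =>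
    (k.factorial : ℂ)⁻¹ • ζ ^ k • iteratedLineDeriv k f v z with hF
  have hFle : ∀ k ζ, ‖F k ζ‖ ≤ ‖ζ‖ ^ k := by
    intro k ζ
    have hk : (0 : ℝ) < k.factorial := by positivity
    simp only [hF, norm_smul, norm_inv, norm_pow, Complex.norm_natCast]
    calc _ ≤ (k.factorial : ℝ)⁻¹ * (‖ζ‖ ^ k * k.factorial) := by gcongr; exact hv k
      _ = _ := by field_simp
  have hF0 : ∀ ζ, F 0 ζ = 0 := by intro ζ; simp [hF, iteratedLineDeriv, hfz]
  have hsum : Summable fun k : ℕ => τ ^ k := summable_geometric_of_lt_one hτ0.le hτ1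
  set φ : ℂ → EuclideanSpace ℂ (Fin n) := fun ζ => ∑' k, F k ζ with hφ
  have hφd : DifferentiableOn ℂ φ (ball 0 τ) := by
    refine Complex.differentiableOn_tsum_of_summable_norm hsum (fun k => ?_) isOpen_ball
      fun k ζ hζ => (hFle k ζ).trans ?_
    · simp only [hF]; fun_prop
    · gcongr; simpa using (mem_ball_zero_iff.1 hζ).le
  have hφm : MapsTo φ (ball 0 τ) (ball 0 c) := by
    intro ζ hζ
    rw [mem_ball_zero_iff] at hζ ⊢
    have hs : Summable fun k : ℕ => ‖ζ‖ ^ k :=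
      summable_geometric_of_lt_one (norm_nonneg _) (hζ.trans hτ1)
    have hsF : Summable fun k => F k ζ := Summable.of_norm_bounded hs (hFle · ζ)
    have h1 : φ ζ = ∑' k, F (k + 1) ζ := by
      simp only [hφ]
      rw [hsF.tsum_eq_zero_add, hF0, zero_add]
    have h2 : HasSum (fun k : ℕ => ‖ζ‖ ^ (k + 1)) ((1 - ‖ζ‖)⁻¹ * ‖ζ‖) := by
      simpa only [pow_succ] using
        (hasSum_geometric_of_lt_one (norm_nonneg ζ) (hζ.trans hτ1)).mul_right ‖ζ‖
    have h3 : ‖φ ζ‖ ≤ (1 - ‖ζ‖)⁻¹ * ‖ζ‖ := by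
      rw [h1]; exact tsum_of_norm_bounded h2 fun k => hFle _ ζ
    have h4 : 0 < 1 - ‖ζ‖ := by linarith
    refine h3.trans_lt ?_
    rw [inv_mul_lt_iff₀ h4]
    rw [hτ, lt_div_iff₀ (by positivity)] at hζ
    linarith
  have hψ : DifferentiableOn ℂ (fun ζ => g (φ ζ)) (ball 0 τ) := hgd.comp hφd hφm
  have hline : DifferentiableOn ℂ (fun ζ : ℂ => z + ζ • v) (ball 0 τ) := by fun_prop
  have hev : (fun ζ => g (φ ζ)) =ᶠ[𝓝 0] fun ζ : ℂ => z + ζ • v := by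
    have hO : IsOpen {ζ : ℂ | z + ζ • v ∈ D} := isOpen_setOf_add_smul_mem hD z v
    obtain ⟨ε, hε, hεD⟩ := Metric.isOpen_iff.1 hO 0 (by simpa using hz)
    have hfd : DifferentiableOn ℂ (fun ζ : ℂ => f (z + ζ • v)) (ball 0 ε) :=
      ((isLineHolomorphicOn_of_differentiableOn hf.holomorphic).differentiableOn_line z v).mono hεD
    filter_upwards [ball_mem_nhds (0 : ℂ) hε] with ζ hζ
    have := (Complex.hasSum_taylorSeries_on_ball hfd hζ).tsum_eq
    simp only [sub_zero] at this
    have h5 : φ ζ = f (z + ζ • v) := this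
    rw [h5, hgl _ (hεD hζ)]
  -- The identity theorem needs no prior knowledge that the line stays in `D`: both sides are
  -- holomorphic on the whole disc.
  have heq := AnalyticOnNhd.eqOn_of_preconnected_of_eventuallyEq (hψ.analyticOnNhd isOpen_ball)
    (hline.analyticOnNhd isOpen_ball) (convex_ball _ _).isPreconnected (mem_ball_self hτ0) hev
  have hζ' : ζ ∈ ball (0 : ℂ) τ := by simpa using hζ
  have hmem : g (φ ζ) ∈ D := hgm (hφm hζ')
  rwa [show g (φ ζ) = z + ζ • v from heq hζ'] at hmem

theorem exists_embedding_of_lt_squeezingFunction {n : ℕ} {D : Set (EuclideanSpace ℂ (Fin n))}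
    {p : EuclideanSpace ℂ (Fin n)} {c : ℝ} (hc : 0 ≤ c) (h : c < squeezingFunction D p) :
    ∃ f : EuclideanSpace ℂ (Fin n) → EuclideanSpace ℂ (Fin n),
      IsHolomorphicEmbeddingInBall D f ∧ f p = 0 ∧ ball 0 c ⊆ f '' D := by
  -- Since `sSup ∅ = 0` in `ℝ`, a supremum above `c ≥ 0` cannot come from the empty set.
  have nonempty_of_lt : ∀ {S : Set ℝ}, c < sSup S → S.Nonempty := by
    intro S hS
    rw [nonempty_iff_ne_empty]
    rintro rfl
    rw [Real.sSup_empty] at hS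
    linarith
  obtain ⟨s, ⟨f, hf, hfp, rfl⟩, hs⟩ := exists_lt_of_lt_csSup (nonempty_of_lt h) h
  obtain ⟨r, hr, hcr⟩ := exists_lt_of_lt_csSup (nonempty_of_lt hs) hs
  exact ⟨f, hf, hfp, (ball_subset_ball hcr.le).trans hr⟩

theorem add_smul_mem_of_lt_infDist {E : Type*} [NormedAddCommGroup E] [NormedSpace ℂ E]
    {D : Set E} {z v : E} (h : ‖v‖ < infDist z Dᶜ) {ζ : ℂ} (hζ : ‖ζ‖ ≤ 1) : z + ζ • v ∈ D := by
  by_contra hcon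
  have h1 := infDist_le_dist_of_mem (x := z) (mem_compl hcon)
  rw [dist_self_add_right, norm_smul] at h1
  nlinarith [norm_nonneg v]

/-- Points much closer to the boundary than a given distance `r` are separated by a holomorphic
function from the set of points of boundary distance at least `r`. -/
theorem exists_separating_of_squeezing {n : ℕ} {D : Set (EuclideanSpace ℂ (Fin n))} (hD : IsOpen D)
    (hne : Dᶜ.Nonempty) {c : ℝ} (hc : 0 < c) {z : EuclideanSpace ℂ (Fin n)} (hz : z ∈ D)
    (hcz : c < squeezingFunction D z) {r : ℝ}
    (hzr : infDist z Dᶜ < c / (1 + c) / 2 * r) :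
    ∃ h : EuclideanSpace ℂ (Fin n) → ℂ, IsLineHolomorphicOn h D ∧
      (∀ w, r ≤ infDist w Dᶜ → ‖h w‖ ≤ 1) ∧ 1 < ‖h z‖ := by
  obtain ⟨f, hf, hfz, hcf⟩ := exists_embedding_of_lt_squeezingFunction hc.le hcz
  set τ := c / (1 + c) with hτ
  have hτ0 : 0 < τ := by positivity
  obtain ⟨w, hw, hzw⟩ := (infDist_lt_iff hne).1 hzr
  set v : EuclideanSpace ℂ (Fin n) := ((τ / 2 : ℝ) : ℂ)⁻¹ • (w - z) with hv
  have hvw : z + ((τ / 2 : ℝ) : ℂ) • v = w := by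
    rw [hv, smul_inv_smul₀ (by exact_mod_cast (half_pos hτ0).ne')]; abel
  have hvr : ‖v‖ < r := by
    rw [hv, norm_smul, norm_inv, Complex.norm_real, Real.norm_of_nonneg (half_pos hτ0).le,
      inv_mul_lt_iff₀ (half_pos hτ0), ← dist_eq_norm, dist_comm]
    exact hzw
  have hlf := isLineHolomorphicOn_of_differentiableOn hf.holomorphic
  obtain ⟨k, hk⟩ : ∃ k : ℕ, (k.factorial : ℝ) < ‖iteratedLineDeriv k f v z‖ := by
    by_contra! hcon
    refine hw (hvw ▸ hf.add_smul_mem hD hc hcf hz hfz hcon ?_)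
    rw [Complex.norm_real, Real.norm_of_nonneg (half_pos hτ0).le]
    exact half_lt_self hτ0
  have hk0 : (0 : ℝ) < k.factorial := by positivity
  obtain ⟨ℓ, hℓ, hℓz⟩ := exists_dual_vector ℂ (iteratedLineDeriv k f v z) (by linarith)
  refine ⟨fun y => ((k.factorial : ℂ)⁻¹ • ℓ) (iteratedLineDeriv k f v y),
    (hlf.iteratedLineDeriv hD v k).clm_comp _, fun y hy => ?_, ?_⟩
  · have h1 := hlf.norm_iteratedLineDeriv_le (M := 1)
      (fun x hx => (mem_ball_zero_iff.1 (hf.mapsTo hx)).le)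
      (fun ζ hζ => add_smul_mem_of_lt_infDist (hvr.trans_le hy) hζ) k
    have h2 := ℓ.le_opNorm (iteratedLineDeriv k f v y)
    rw [hℓ, one_mul] at h2
    simp only [_root_.smul_apply, norm_smul, norm_inv, Complex.norm_natCast]
    rw [inv_mul_le_iff₀ hk0]
    exact h2.trans h1
  · simp only [_root_.smul_apply, norm_smul, norm_inv, Complex.norm_natCast, hℓz]
    rw [lt_inv_mul_iff₀ hk0]
    simpa using hk

/-! ### Plurisubharmonic functions and the exhaustion -/

theorem IsLineHolomorphicOn.isContinuousPlurisubharmonicOn_norm {n : ℕ}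
    {D : Set (EuclideanSpace ℂ (Fin n))} {F : Type*} [NormedAddCommGroup F] [NormedSpace ℂ F]
    [CompleteSpace F] {h : EuclideanSpace ℂ (Fin n) → F} (hh : IsLineHolomorphicOn h D) :
    IsContinuousPlurisubharmonicOn (fun z => ‖h z‖) D where
  continuousOn := hh.continuousOn.norm
  le_circleAverage _ _ hzv := hh.norm_le_circleAverage hzv

section Plurisubharmonic

variable {n : ℕ} {D : Set (EuclideanSpace ℂ (Fin n))}

theorem circleIntegrable_of_continuousOn {u : EuclideanSpace ℂ (Fin n) → ℝ}
    (hu : ContinuousOn u D) {z v : EuclideanSpace ℂ (Fin n)}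
    (h : ∀ ζ : ℂ, ‖ζ‖ ≤ 1 → z + ζ • v ∈ D) :
    CircleIntegrable (fun ζ : ℂ => u (z + ζ • v)) 0 1 :=
  ContinuousOn.circleIntegrable zero_le_one <|
    hu.comp (by fun_prop) fun ζ hζ => h ζ (mem_sphere_zero_iff_norm.1 hζ).le

theorem isContinuousPlurisubharmonicOn_zero :
    IsContinuousPlurisubharmonicOn (fun _ : EuclideanSpace ℂ (Fin n) => (0 : ℝ)) D where
  continuousOn := continuousOn_const
  le_circleAverage _ _ _ := by rw [Real.circleAverage_const]

theorem IsContinuousPlurisubharmonicOn.add {u w : EuclideanSpace ℂ (Fin n) → ℝ}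
    (hu : IsContinuousPlurisubharmonicOn u D) (hw : IsContinuousPlurisubharmonicOn w D) :
    IsContinuousPlurisubharmonicOn (fun z => u z + w z) D where
  continuousOn := hu.continuousOn.add hw.continuousOn
  le_circleAverage z v h := by
    rw [Real.circleAverage_fun_add (circleIntegrable_of_continuousOn hu.continuousOn h)
      (circleIntegrable_of_continuousOn hw.continuousOn h)]
    exact add_le_add (hu.le_circleAverage z v h) (hw.le_circleAverage z v h)

theorem isContinuousPlurisubharmonicOn_sum {s : ℕ → EuclideanSpace ℂ (Fin n) → ℝ}
    (hs : ∀ i, IsContinuousPlurisubharmonicOn (s i) D) (N : ℕ) :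
    IsContinuousPlurisubharmonicOn (fun z => ∑ i ∈ Finset.range N, s i z) D := by
  induction N with
  | zero => simpa using isContinuousPlurisubharmonicOn_zero
  | succ N ih => simpa only [Finset.sum_range_succ] using ih.add (hs N)

theorem summable_of_eventually_le_geometric {f : ℕ → ℝ} (h0 : ∀ i, 0 ≤ f i) {J : ℕ}
    (hJ : ∀ i, J ≤ i → f i ≤ (1 / 2 : ℝ) ^ i) : Summable f :=
  (summable_nat_add_iff J).1 <| Summable.of_nonneg_of_le (fun _ => h0 _)
    (fun i => hJ (i + J) (Nat.le_add_left _ _)) ((summable_nat_add_iff J).2 summable_geometric_two)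

theorem isContinuousPlurisubharmonicOn_tsum {s : ℕ → EuclideanSpace ℂ (Fin n) → ℝ}
    (hs : ∀ i, IsContinuousPlurisubharmonicOn (s i) D) (h0 : ∀ i z, 0 ≤ s i z)
    (hloc : ∀ x ∈ D, ∃ J : ℕ, ∀ᶠ y in 𝓝 x, ∀ i, J ≤ i → s i y ≤ (1 / 2 : ℝ) ^ i) (hD : IsOpen D) :
    IsContinuousPlurisubharmonicOn (fun z => ∑' i, s i z) D := by
  have hsum : ∀ x ∈ D, Summable fun i => s i x := by
    intro x hx
    obtain ⟨J, hJ⟩ := hloc x hx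
    exact summable_of_eventually_le_geometric (h0 · x) hJ.self_of_nhds
  have hcont : ContinuousOn (fun z => ∑' i, s i z) D := by
    intro x hx
    obtain ⟨J, hJ⟩ := hloc x hx
    have hV := inter_mem (hD.mem_nhds hx) hJ
    set V := D ∩ {y | ∀ i, J ≤ i → s i y ≤ (1 / 2 : ℝ) ^ i}
    have h1 : ContinuousOn (fun z => ∑ i ∈ Finset.range J, s i z + ∑' i, s (i + J) z) V := by
      refine ContinuousOn.add ((isContinuousPlurisubharmonicOn_sum hs J).continuousOn.mono
        inter_subset_left) ?_
      refine continuousOn_tsum (fun i => (hs _).continuousOn.mono inter_subset_left)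
        ((summable_nat_add_iff J).2 summable_geometric_two) fun i y hy => ?_
      rw [Real.norm_of_nonneg (h0 _ _)]
      exact hy.2 _ (Nat.le_add_left _ _)
    refine ((h1.congr fun y hy => ?_).continuousAt hV).continuousWithinAt
    exact ((hsum y hy.1).sum_add_tsum_nat_add J).symm
  refine ⟨hcont, fun z v hzv => ?_⟩
  have hz : z ∈ D := by simpa using hzv 0 (by simp)
  -- Partial sums lie below the full sum, so their circle averages do too; no exchange of limit and
  -- integral is needed.
  refine le_of_tendsto' (hsum z hz).hasSum.tendsto_sum_nat fun N => ?_
  have hN := isContinuousPlurisubharmonicOn_sum hs N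
  refine (hN.le_circleAverage z v hzv).trans (Real.circleAverage_mono
    (circleIntegrable_of_continuousOn hN.continuousOn hzv)
    (circleIntegrable_of_continuousOn hcont hzv) fun ζ hζ => ?_)
  rw [abs_one] at hζ
  exact (hsum _ (hzv ζ (mem_sphere_zero_iff_norm.1 hζ).le)).sum_le_tsum _ fun i _ => h0 i _

/-- Pointwise separation of `S` from `K` by holomorphic functions gives a plurisubharmonic function
that is small on `K` and large on `S`. -/
theorem exists_plurisubharmonic_separating {K S : Set (EuclideanSpace ℂ (Fin n))}
    (hS : IsCompact S) (hSD : S ⊆ D)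
    (hsep : ∀ z ∈ S, ∃ h : EuclideanSpace ℂ (Fin n) → ℂ, IsLineHolomorphicOn h D ∧
      (∀ w ∈ K, ‖h w‖ ≤ 1) ∧ 1 < ‖h z‖) (M : ℝ) {ε : ℝ} (hε : 0 < ε) :
    ∃ s : EuclideanSpace ℂ (Fin n) → ℝ, IsContinuousPlurisubharmonicOn s D ∧ (∀ z, 0 ≤ s z) ∧
      (∀ w ∈ K, s w ≤ ε) ∧ ∀ z ∈ S, M < s z := by
  -- The bound `ε` is halved at each union in the compactness induction, so it must be universally
  -- quantified.
  suffices H : ∀ ε > 0, ∃ s : EuclideanSpace ℂ (Fin n) → ℝ, IsContinuousPlurisubharmonicOn s D ∧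
      (∀ z, 0 ≤ s z) ∧ (∀ w ∈ K, s w ≤ ε) ∧ ∀ z ∈ S, M < s z from H ε hε
  refine hS.induction_on (p := fun S => ∀ ε > 0, ∃ s : EuclideanSpace ℂ (Fin n) → ℝ,
    IsContinuousPlurisubharmonicOn s D ∧ (∀ z, 0 ≤ s z) ∧ (∀ w ∈ K, s w ≤ ε) ∧ ∀ z ∈ S, M < s z)
    ?_ ?_ ?_ ?_
  · exact fun ε hε => ⟨_, isContinuousPlurisubharmonicOn_zero, fun _ => le_rfl,
      fun _ _ => hε.le, fun _ hz => hz.elim⟩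
  · intro S T hST hT ε hε
    obtain ⟨s, h1, h2, h3, h4⟩ := hT ε hε
    exact ⟨s, h1, h2, h3, fun z hz => h4 z (hST hz)⟩
  · intro S T hS hT ε hε
    obtain ⟨s, h1, h2, h3, h4⟩ := hS (ε / 2) (half_pos hε)
    obtain ⟨t, k1, k2, k3, k4⟩ := hT (ε / 2) (half_pos hε)
    refine ⟨_, h1.add k1, fun z => add_nonneg (h2 z) (k2 z),
      fun w hw => (add_le_add (h3 w hw) (k3 w hw)).trans_eq (add_halves ε), ?_⟩
    rintro z (hz | hz)
    · exact (h4 z hz).trans_le (le_add_of_nonneg_right (k2 z))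
    · exact (k4 z hz).trans_le (le_add_of_nonneg_left (h2 z))
  · intro z hz
    obtain ⟨h, hh, hK, hhz⟩ := hsep z hz
    -- After division by `a`, the modulus is at most `a⁻¹ < 1` on `K` and exceeds `A > 1` near `z`;
    -- a high power is then small on `K` and large near `z`.
    obtain ⟨a, ha1, haz⟩ := exists_between hhz
    have ha0 : 0 < a := by linarith
    have hz1 : 1 < ‖h z‖ / a := (one_lt_div ha0).2 haz
    obtain ⟨A, hA1, hAz⟩ := exists_between hz1
    refine ⟨{y | A < ‖h y‖ / a}, nhdsWithin_mono z hSD ?_, fun ε hε => ?_⟩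
    · exact ((hh.continuousOn.norm.div_const a) z (hSD hz)).eventually_const_lt hAz
    obtain ⟨m, hm1, hm2⟩ := (((tendsto_pow_atTop_nhds_zero_of_lt_one (inv_nonneg.2 ha0.le)
      (inv_lt_one_of_one_lt₀ ha1)).eventually_lt_const hε).and
      ((tendsto_pow_atTop_atTop_of_one_lt hA1).eventually_gt_atTop M)).exists
    have hn : ∀ y, ‖(((a : ℂ)⁻¹ • ContinuousLinearMap.id ℂ ℂ) (h y)) ^ m‖ = (‖h y‖ / a) ^ m := by
      intro y
      simp [abs_of_pos ha0, div_eq_inv_mul]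
    refine ⟨_, ((hh.clm_comp ((a : ℂ)⁻¹ • ContinuousLinearMap.id ℂ ℂ)).pow
      m).isContinuousPlurisubharmonicOn_norm, fun _ => norm_nonneg _, fun w hw => ?_, fun y hy => ?_⟩
    · rw [hn]
      refine le_trans ?_ hm1.le
      rw [div_eq_inv_mul]
      have := hK w hw
      gcongr
      exact mul_le_of_le_one_right (inv_nonneg.2 ha0.le) this
    · rw [hn]
      refine hm2.trans_le ?_
      have : A ≤ ‖h y‖ / a := le_of_lt hy
      gcongr

/-- An open bounded set in which points of boundary distance at most `ρ * r` are separated by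
holomorphic functions from the points of boundary distance at least `r` is pseudoconvex. -/
theorem isPseudoconvex_of_separating (hD : IsOpen D) (hb : Bornology.IsBounded D)
    (hne : Dᶜ.Nonempty) {ρ : ℝ} (hρ0 : 0 < ρ) (hρ1 : ρ < 1)
    (hsep : ∀ z ∈ D, ∀ r > 0, infDist z Dᶜ < ρ * r →
      ∃ h : EuclideanSpace ℂ (Fin n) → ℂ, IsLineHolomorphicOn h D ∧
        (∀ w, r ≤ infDist w Dᶜ → ‖h w‖ ≤ 1) ∧ 1 < ‖h z‖) : IsPseudoconvex D := by
  set δ : EuclideanSpace ℂ (Fin n) → ℝ := fun z => infDist z Dᶜ with hδ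
  have hδc : Continuous δ := continuous_infDist_pt _
  have hδpos : ∀ z ∈ D, 0 < δ z := fun z hz =>
    (hD.isClosed_compl.notMem_iff_infDist_pos hne).1 (notMem_compl_iff.2 hz)
  have hδD : ∀ z, 0 < δ z → z ∈ D := fun z hz =>
    notMem_compl_iff.1 ((hD.isClosed_compl.notMem_iff_infDist_pos hne).2 hz)
  have hKc : ∀ r > 0, IsCompact {z | r ≤ δ z} := fun r hr =>
    isCompact_of_isClosed_isBounded (isClosed_le continuous_const hδc)
      (hb.subset fun z hz => hδD z (hr.trans_le hz))
  -- The shells cover `{0 < δ ≤ ρ ^ 2}`. The exponent `j + 2` makes `δ` strictly less than `ρ * ρ ^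
  -- j` on the shell.
  have hstep : ∀ j : ℕ, ∃ s : EuclideanSpace ℂ (Fin n) → ℝ, IsContinuousPlurisubharmonicOn s D ∧
      (∀ z, 0 ≤ s z) ∧ (∀ w ∈ {w | ρ ^ j ≤ δ w}, s w ≤ (1 / 2 : ℝ) ^ j) ∧
      ∀ z ∈ {z | ρ ^ (j + 3) ≤ δ z} ∩ {z | δ z ≤ ρ ^ (j + 2)}, (j : ℝ) < s z := by
    intro j
    refine exists_plurisubharmonic_separating ((hKc _ (by positivity)).inter_right
      (isClosed_le hδc continuous_const)) (fun z hz => hδD z (lt_of_lt_of_le (by positivity) hz.1))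
      (fun z hz => ?_) j (by positivity)
    refine hsep z (hδD z (lt_of_lt_of_le (by positivity) hz.1)) (ρ ^ j) (by positivity) ?_
    rw [← pow_succ']
    exact lt_of_le_of_lt hz.2 (pow_lt_pow_right_of_lt_one₀ hρ0 hρ1 (by omega))
  choose s hs h0 hsK hsS using hstep
  have hloc : ∀ x ∈ D, ∃ J : ℕ, ∀ᶠ y in 𝓝 x, ∀ i, J ≤ i → s i y ≤ (1 / 2 : ℝ) ^ i := by
    intro x hx
    obtain ⟨J, hJ⟩ := exists_pow_lt_of_lt_one (hδpos x hx) hρ1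
    refine ⟨J, ?_⟩
    filter_upwards [hδc.continuousAt.eventually_const_lt hJ] with y hy i hi
    exact hsK i y ((pow_le_pow_of_le_one hρ0.le hρ1.le hi).trans hy.le)
  have hu := isContinuousPlurisubharmonicOn_tsum hs h0 hloc hD
  refine ⟨hD, _, hu, fun t => ?_⟩
  obtain ⟨N, hN⟩ := exists_nat_gt t
  have hK := hKc (ρ ^ (N + 2)) (by positivity)
  have hsub : ∀ z ∈ D, ∑' i, s i z ≤ t → ρ ^ (N + 2) ≤ δ z := by
    intro z hz hzt
    by_contra! hlt
    obtain ⟨k, hk1, hk2⟩ := exists_nat_pow_near_of_lt_one (hδpos z hz)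
      (hlt.le.trans (pow_le_one₀ hρ0.le hρ1.le)) hρ0 hρ1
    have hkN : N + 2 < k + 1 := (pow_lt_pow_iff_right_of_lt_one₀ hρ0 hρ1).1 (hk1.trans hlt)
    obtain ⟨j, rfl⟩ : ∃ j, k = j + 2 := ⟨k - 2, by omega⟩
    have h1 := hsS j z ⟨hk1.le, hk2⟩
    obtain ⟨J, hJ⟩ := hloc z hz
    have h2 := (summable_of_eventually_le_geometric (h0 · z) hJ.self_of_nhds).le_tsum j
      fun i _ => h0 i z
    have h3 : (N : ℝ) ≤ j := by exact_mod_cast (by omega : N ≤ j)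
    linarith
  have heq : {z | z ∈ D ∧ ∑' i, s i z ≤ t} =
      {z | ρ ^ (N + 2) ≤ δ z} ∩ (fun z => ∑' i, s i z) ⁻¹' Iic t := by
    ext z
    exact ⟨fun hz => ⟨hsub z hz.1 hz.2, hz.2⟩,
      fun hz => ⟨hδD z (lt_of_lt_of_le (by positivity) hz.1), hz.2⟩⟩
  rw [heq]
  exact hK.of_isClosed_subset (ContinuousOn.preimage_isClosed_of_isClosed
    (hu.continuousOn.mono fun z hz => hδD z (lt_of_lt_of_le (by positivity) hz)) hK.isClosed
    isClosed_Iic) inter_subset_left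

end Plurisubharmonic

end SCV

theorem mainTheorem7 (n : ℕ) (hn : 1 ≤ n) (D : Set (EuclideanSpace ℂ (Fin n)))
    (hD : SCV.IsHolomorphicHomogeneousRegular D) : SCV.IsPseudoconvex D := by
  obtain ⟨⟨hDo, -, hDb⟩, c, hc, hcD⟩ := hD
  -- For `n ≥ 1` the whole space is unbounded, so `D` omits a point.
  have hne : Dᶜ.Nonempty := by
    rw [Set.nonempty_compl]
    rintro rfl
    have : Nonempty (Fin n) := ⟨⟨0, hn⟩⟩
    exact NormedSpace.unbounded_univ ℂ (EuclideanSpace ℂ (Fin n)) hDb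
  -- Halving `c` makes the lower bound on the squeezing function strict, as needed to extract an
  -- actual embedding.
  refine SCV.isPseudoconvex_of_separating hDo hDb hne (ρ := c / 2 / (1 + c / 2) / 2)
    (by positivity) ?_ fun z hz r _ hzr => SCV.exists_separating_of_squeezing hDo hne
      (half_pos hc) hz ((half_lt_self hc).trans_le (hcD z hz)) hzr
  have : c / 2 / (1 + c / 2) < 1 := by rw [div_lt_one (by positivity)]; linarith
  linarith
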